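/- Let $\mathsf{Pos}$ be the category of posets and monotone maps, and let $\mathsf{Pos}_{\mathsf f}$ be a set of finite posets (called contexts) representing all finite posets up to isomorphism. A signature is a family $\Sigma=(\Sigma_\Gamma)_{\Gamma\in\mathsf{Pos}_{\mathsf f}}$ of sets. A $\Sigma$-algebra is a poset $A$ with a (not necessarily monotone) function $\sigma_A\colon\mathsf{Pos}_0(\Gamma,A)\to A$ for every $\Gamma$ and every $\sigma\in\Sigma_\Gamma$, where $\mathsf{Pos}_0(\Gamma,A)$ is the set of monotone maps $\Gamma\to A$. A homomorphism $h\colon A\to B$ is a monotone map with $h(\sigma_A(f))=\sigma_B(h\cdot f)$ for all $\sigma$ and $f$. The algebra $A$ is coherent if every $\sigma_A$ is monotone for the pointwise order on monotone maps. Terms in context $\Gamma$ are the usual ones over the set $|\Gamma|$, the order of arities being ignored: each $x\in|\Gamma|$ is a term, and for $\sigma\in\Sigma_\Delta$ and each function $g$ from $|\Delta|$ to terms, $\sigma(g)$ is a term. For a monotone $f\colon\Gamma\to A$ the evaluation $f^\#$ is the partial map from terms to $A$ with $f^\#(x)=f(x)$ for $x \in |\Gamma|$, and with $f^\#(\sigma(g))=\sigma_A(f^\#\cdot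 g)$, defined iff all $f^\#(g(i))$, $i\in\Delta$, are defined and $i\le j$ in $\Delta$ implies $f^\#(g(i))\le f^\#(g(j))$. The algebra $A$ satisfies an inequation $\Gamma\vdash s\le t$ between terms in context $\Gamma$ if for every monotone $f\colon\Gamma\to A$ both $f^\#(s)$ and $f^\#(t)$ are defined and $f^\#(s)\le f^\#(t)$. A variety is the full subcategory of the category of all $\Sigma$-algebras (or of the category of all coherent $\Sigma$-algebras) given by the algebras that satisfy every member of a given set of inequations in context. For every variety $\mathcal V$, of $\Sigma$-algebras or of coherent $\Sigma$-algebras, the forgetful functor $U\colon\mathcal V\to\mathsf{Pos}$ has a left adjoint; let $\mathbb T_{\mathcal V}$ be the monad on $\mathsf{Pos}$ of the resulting adjunction (the free-algebra monad). Then $\mathcal V$ is isomorphic, as a concrete category over $\mathsf{Pos}$, to the Eilenberg--Moore category $\mathsf{Pos}^{\mathbb T_{\mathcal V}}$; that is, there is an isomorphism of categories $K\colon\mathcal V\to\mathsf{Pos}^{\mathbb T_{\mathcal V}}$ whose composite with the forgetful functor $\mathsf{Pos}^{\mathbb T_{\mathcal V}}\to\mathsf{Pos}$ equals $U$. -/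

import Mathlib

open CategoryTheory

universe u

namespace OrdVar

/-- A partial order on a finite ordinal. -/
structure FinPoset : Type where
  card : ℕ
  order : PartialOrder (Fin card)

/-- The underlying set of a `FinPoset`, as a type of its own so that the order of `P` is not mixed up
with the usual linear order of `Fin n`. -/
def FinPoset.Elem (P : FinPoset) : Type := Fin P.card

instance (P : FinPoset) : PartialOrder P.Elem := P.order

instance (P : FinPoset) : Fintype P.Elem := inferInstanceAs (Fintype (Fin P.card))

/-- Order isomorphism of finite posets. -/
instance FinPoset.isoSetoid : Setoid FinPoset where
  r P Q := Nonempty (P.Elem ≃o Q.Elem)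
  iseqv := ⟨fun _ => ⟨OrderIso.refl _⟩, fun ⟨e⟩ => ⟨e.symm⟩, fun ⟨e⟩ ⟨e'⟩ => ⟨e.trans e'⟩⟩

/-- The set of contexts: isomorphism classes of finite posets, each of which stands for one chosen
representative (`PosF.Elem`). -/
def PosF : Type := Quotient FinPoset.isoSetoid

/-- The poset of variables of a context: the chosen representative of the class. -/
noncomputable def PosF.Elem (Γ : PosF) : Type := (Quotient.out Γ).Elem

noncomputable instance (Γ : PosF) : PartialOrder Γ.Elem :=
  inferInstanceAs (PartialOrder (Quotient.out Γ).Elem)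

noncomputable instance (Γ : PosF) : Fintype Γ.Elem :=
  inferInstanceAs (Fintype (Quotient.out Γ).Elem)

/-- Every finite poset is isomorphic to exactly one context. -/
theorem PosF.existsUnique_iso (P : Type*) [PartialOrder P] [Finite P] :
    ∃! Γ : PosF, Nonempty (P ≃o Γ.Elem) := by
  obtain ⟨n, ⟨e⟩⟩ := Finite.exists_equiv_fin P
  let Q : FinPoset := ⟨n, PartialOrder.lift e.symm e.symm.injective⟩
  let i : P ≃o Q.Elem := ⟨e, by
    intro a b
    change e.symm (e a) ≤ e.symm (e b) ↔ a ≤ b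
    simp⟩
  let Γ₀ : PosF := Quotient.mk FinPoset.isoSetoid Q
  obtain ⟨j⟩ : Nonempty (Γ₀.Elem ≃o Q.Elem) := Quotient.mk_out (s := FinPoset.isoSetoid) Q
  refine ⟨Γ₀, ⟨i.trans j.symm⟩, ?_⟩
  rintro Γ ⟨k⟩
  have h : Quotient.mk FinPoset.isoSetoid (Quotient.out Γ) = Γ₀ :=
    Quotient.sound ⟨k.symm.trans i⟩
  exact (Quotient.out_eq Γ).symm.trans h

/-- A signature in context: a family of sets `S Γ` of operation symbols of arity `Γ`. -/
abbrev Signature : Type (u + 1) := PosF → Type u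

/-- An `S`-algebra: a poset with an element `op σ f` for every operation symbol `σ` of arity `Γ` and
every monotone map `f` from `Γ`. The operations need not be monotone. -/
structure Alg (S : Signature.{u}) : Type (u + 1) where
  carrier : PartOrd.{u}
  op : ∀ {Γ : PosF}, S Γ → (Γ.Elem →o carrier) → carrier

/-- Homomorphisms: monotone maps that commute with the operations. -/
@[ext]
structure Alg.Hom {S : Signature.{u}} (A B : Alg S) : Type u where
  toOrderHom : A.carrier →o B.carrier
  map_op : ∀ {Γ : PosF} (σ : S Γ) (f : Γ.Elem →o A.carrier),
    toOrderHom (A.op σ f) = B.op σ (toOrderHom.comp f)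

/-- The category of `S`-algebras and monotone homomorphisms. -/
instance (S : Signature.{u}) : Category.{u} (Alg S) where
  Hom A B := Alg.Hom A B
  id A := ⟨OrderHom.id, fun _ _ => rfl⟩
  comp g h := ⟨h.toOrderHom.comp g.toOrderHom, fun σ f => by
    simp only [OrderHom.comp_coe, Function.comp_apply, g.map_op, h.map_op]
    rfl⟩

/-- The forgetful functor to posets. -/
def Alg.forget (S : Signature.{u}) : Alg S ⥤ PartOrd.{u} where
  obj A := A.carrier
  map h := PartOrd.ofHom h.toOrderHom

/-- An algebra is coherent if every operation is monotone for the pointwise order on monotone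
maps. -/
def Alg.Coherent {S : Signature.{u}} (A : Alg S) : Prop :=
  ∀ {Γ : PosF} (σ : S Γ), Monotone (A.op σ)

/-- The category of coherent `S`-algebras. -/
abbrev CohAlg (S : Signature.{u}) : Type (u + 1) :=
  ObjectProperty.FullSubcategory (fun A : Alg S => A.Coherent)

/-- Terms in context `Γ`; the order of the arities is ignored. -/
inductive Term (S : Signature.{u}) (Γ : PosF) : Type u
  | var (x : Γ.Elem) : Term S Γ
  | op {Δ : PosF} (σ : S Δ) (g : Δ.Elem → Term S Γ) : Term S Γ

/-- The partial evaluation map of a monotone interpretation `f` of the variables: `σ(g)` has a value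
iff all `g i` have values and these depend monotonically on `i`. -/
noncomputable def Alg.eval {S : Signature.{u}} (A : Alg S) {Γ : PosF} (f : Γ.Elem →o A.carrier) :
    Term S Γ → Part A.carrier
  | .var x => Part.some (f x)
  | .op σ g =>
    ⟨∃ h : ∀ i, (A.eval f (g i)).Dom, Monotone fun i => (A.eval f (g i)).get (h i),
      fun p => A.op σ ⟨fun i => (A.eval f (g i)).get (p.fst i), p.snd⟩⟩

/-- An inequation in context, `ctx ⊢ lhs ≤ rhs`. -/
structure Inequation (S : Signature.{u}) : Type u where
  ctx : PosF
  lhs : Term S ctx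
  rhs : Term S ctx

/-- Satisfaction: under every monotone interpretation both sides are defined, and the inequality
holds. -/
def Alg.Satisfies {S : Signature.{u}} (A : Alg S) (e : Inequation S) : Prop :=
  ∀ f : e.ctx.Elem →o A.carrier,
    ∃ (hl : (A.eval f e.lhs).Dom) (hr : (A.eval f e.rhs).Dom),
      (A.eval f e.lhs).get hl ≤ (A.eval f e.rhs).get hr

/-- The variety of `S`-algebras specified by a set `E` of inequations in context, as a full
subcategory of the category of `S`-algebras. -/
abbrev Variety (S : Signature.{u}) (E : Set (Inequation S)) : Type (u + 1) :=
  ObjectProperty.FullSubcategory (fun A : Alg S => ∀ e ∈ E, A.Satisfies e)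

/-- The forgetful functor of a variety. -/
def Variety.forget (S : Signature.{u}) (E : Set (Inequation S)) : Variety S E ⥤ PartOrd.{u} :=
  ObjectProperty.ι _ ⋙ Alg.forget S

/-- The variety of coherent `S`-algebras specified by a set `E` of inequations in context, as a full
subcategory of the category of coherent `S`-algebras. -/
abbrev CohVariety (S : Signature.{u}) (E : Set (Inequation S)) : Type (u + 1) :=
  ObjectProperty.FullSubcategory (fun A : CohAlg S => ∀ e ∈ E, A.obj.Satisfies e)

/-- The forgetful functor of a variety of coherent algebras. -/
def CohVariety.forget (S : Signature.{u}) (E : Set (Inequation S)) :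
    CohVariety S E ⥤ PartOrd.{u} :=
  ObjectProperty.ι _ ⋙ ObjectProperty.ι _ ⋙ Alg.forget S

/-- Two categories `C`, `D`, concrete over `B` by `U` and `V`, are isomorphic as concrete categories:
there is an isomorphism of categories (not only an equivalence) that strictly commutes with the
functors to `B`. -/
def ConcretelyIsomorphic {B C D : Type*} [Category* B] [Category* C] [Category* D]
    (U : C ⥤ B) (V : D ⥤ B) : Prop :=
  ∃ (K : C ⥤ D) (L : D ⥤ C), K ⋙ L = 𝟭 C ∧ L ⋙ K = 𝟭 D ∧ K ⋙ V = U

end OrdVar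

/-!
The free algebra on a poset `X` is the subalgebra generated by `X` in the product of all algebras
of the variety that come with a monotone map from `X`. Terms over `X` name its elements, so it is
small although the product is not, and its projections jointly reflect the order, which passes
inequations and coherence on from the factors.

An Eilenberg-Moore algebra `(X, a)` with unit `η` carries the operations `σ(f) = a (σ (η ∘ f))`. By
associativity `a` is a homomorphism from the free algebra, and the monotone map `η` is a section of
it. Inequations and coherence pass to the codomain of a homomorphism with a monotone section, since
every interpretation lifts along the section. Hence `(X, a)` comes from an algebra of the variety.
The comparison functor is therefore an equivalence over posets, and as both forgetful functors are
amnestic, it is an isomorphism.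
-/

namespace OrdVar

section ConcreteCategories

variable {B C D : Type*} [Category* B] [Category* C] [Category* D]

/-- A functor `U` is *amnestic* if an isomorphism that `U` sends to an identity has equal domain and
codomain; for faithful `U` the isomorphism is then itself an identity. The identity in the image is
an `eqToHom`, as `U.obj X` and `U.obj Y` are only propositionally equal. -/
def Amnestic (U : C ⥤ B) : Prop :=
  ∀ ⦃X Y : C⦄ (e : X ≅ Y) (h : U.obj X = U.obj Y), U.map e.hom = eqToHom h → X = Y

theorem Amnestic.comp_of_injective {I : C ⥤ D} {U : D ⥤ B} (hU : Amnestic U)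
    (hI : Function.Injective I.obj) : Amnestic (I ⋙ U) :=
  fun _ _ e h he => hI (hU (I.mapIso e) h he)

theorem amnestic_monad_forget (T : Monad B) : Amnestic T.forget := by
  rintro ⟨X, a, _, _⟩ ⟨Y, b, _, _⟩ e h he
  obtain rfl : X = Y := h
  obtain rfl : a = b := by simpa [show e.hom.f = 𝟙 X from he] using e.hom.h.symm
  rfl

theorem ConcretelyIsomorphic.of_bijective_obj {U : C ⥤ B} {V : D ⥤ B} (K : C ⥤ D) [K.Full]
    [K.Faithful] (hK : Function.Bijective K.obj) (hKV : K ⋙ V = U) :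
    ConcretelyIsomorphic U V := by
  choose o ho using hK.2
  let L : D ⥤ C :=
    { obj := o
      map := fun {X Y} f => K.preimage (eqToHom (ho X) ≫ f ≫ eqToHom (ho Y).symm)
      map_id := fun X => K.map_injective (by simp)
      map_comp := fun f g => K.map_injective (by simp) }
  have hL : ∀ X, o (K.obj X) = X := fun X => hK.1 (ho (K.obj X))
  refine ⟨K, L, CategoryTheory.Functor.ext hL fun X Y f => K.map_injective ?_,
    CategoryTheory.Functor.ext ho fun X Y f => ?_, hKV⟩
  · simp [L, eqToHom_map]
  · simp [L]

theorem ConcretelyIsomorphic.of_amnestic {U : C ⥤ B} {V : D ⥤ B} (K : C ⥤ D) [K.Full]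
    [K.Faithful] (hKV : K ⋙ V = U) (hU : Amnestic U) (hV : Amnestic V)
    (hK : ∀ Y, ∃ (X : C) (e : K.obj X ≅ Y) (h : V.obj (K.obj X) = V.obj Y),
      V.map e.hom = eqToHom h) :
    ConcretelyIsomorphic U V := by
  refine .of_bijective_obj K ⟨fun X Y hXY => ?_, fun Y => ?_⟩ hKV
  · subst hKV
    refine hU (K.preimageIso (eqToIso hXY)) (congrArg V.obj hXY) ?_
    simp [eqToHom_map]
  · obtain ⟨X, e, h, he⟩ := hK Y
    exact ⟨X, hV e h he⟩

end ConcreteCategories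

variable {S : Signature.{u}}

section Evaluation

variable {A B : Alg S} {Γ : PosF}

theorem Alg.mem_eval_op {f : Γ.Elem →o A.carrier} {Δ : PosF} {σ : S Δ}
    {g : Δ.Elem → Term S Γ} {a : A.carrier} :
    a ∈ A.eval f (.op σ g) ↔
      ∃ v : Δ.Elem →o A.carrier, (∀ i, v i ∈ A.eval f (g i)) ∧ A.op σ v = a := by
  constructor
  · rintro ⟨⟨hd, hm⟩, rfl⟩
    exact ⟨⟨_, hm⟩, fun i => Part.get_mem (hd i), rfl⟩
  · rintro ⟨v, hv, rfl⟩
    have hget : ∀ i, (A.eval f (g i)).get (hv i).fst = v i := fun i => (hv i).snd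
    exact ⟨⟨fun i => (hv i).fst, by simpa only [hget] using v.monotone⟩,
      congrArg (A.op σ) (OrderHom.ext _ _ (funext hget))⟩

theorem Alg.satisfies_iff {e : Inequation S} :
    A.Satisfies e ↔ ∀ f : e.ctx.Elem →o A.carrier,
      ∃ a ∈ A.eval f e.lhs, ∃ b ∈ A.eval f e.rhs, a ≤ b := by
  refine forall_congr' fun f => ⟨?_, ?_⟩
  · rintro ⟨hl, hr, hle⟩
    exact ⟨_, Part.get_mem hl, _, Part.get_mem hr, hle⟩
  · rintro ⟨_, ⟨hl, rfl⟩, _, ⟨hr, rfl⟩, hle⟩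
    exact ⟨hl, hr, hle⟩

theorem Alg.Hom.map_mem_eval (h : Alg.Hom A B) {f : Γ.Elem →o A.carrier} {t : Term S Γ}
    {a : A.carrier} (ha : a ∈ A.eval f t) :
    h.toOrderHom a ∈ B.eval (h.toOrderHom.comp f) t := by
  induction t generalizing a with
  | var x =>
    obtain rfl := Part.mem_some_iff.1 ha
    exact Part.mem_some _
  | op σ g ih =>
    obtain ⟨v, hv, rfl⟩ := mem_eval_op.1 ha
    exact mem_eval_op.2 ⟨h.toOrderHom.comp v, fun i => ih i (hv i), (h.map_op σ v).symm⟩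

end Evaluation

section JointlyOrderReflecting

/-- A family of homomorphisms out of `A` jointly reflects the order if it exhibits `A`, up to
isomorphism, as a subalgebra of the product of the codomains, with the induced order. -/
def JointlyOrderReflecting {ι : Type*} {A : Alg S} {B : ι → Alg S} (h : ∀ i, Alg.Hom A (B i)) :
    Prop :=
  ∀ ⦃a b : A.carrier⦄, (∀ i, (h i).toOrderHom a ≤ (h i).toOrderHom b) → a ≤ b

variable {ι : Type*} {A : Alg S} {B : ι → Alg S} {h : ∀ i, Alg.Hom A (B i)}

theorem JointlyOrderReflecting.exists_mem_eval (hr : JointlyOrderReflecting h) {Γ : PosF}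
    {f : Γ.Elem →o A.carrier} {t : Term S Γ}
    (ht : ∀ i, ∃ b, b ∈ (B i).eval ((h i).toOrderHom.comp f) t) : ∃ a, a ∈ A.eval f t := by
  induction t with
  | var x => exact ⟨f x, Part.mem_some _⟩
  | op σ g ih =>
    have hw : ∀ i, ∃ w : _ →o (B i).carrier,
        ∀ j, w j ∈ (B i).eval ((h i).toOrderHom.comp f) (g j) := fun i =>
      let ⟨_, hb⟩ := ht i
      let ⟨w, hw, _⟩ := Alg.mem_eval_op.1 hb
      ⟨w, hw⟩
    choose w hw using hw
    choose v hv using fun j => ih j fun i => ⟨w i j, hw i j⟩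
    have hvw : ∀ i j, (h i).toOrderHom (v j) = w i j := fun i j =>
      Part.mem_unique ((h i).map_mem_eval (hv j)) (hw i j)
    have v_mono : Monotone v := fun j k hjk => hr fun i => by
      rw [hvw, hvw]
      exact (w i).monotone hjk
    exact ⟨_, Alg.mem_eval_op.2 ⟨⟨v, v_mono⟩, hv, rfl⟩⟩

theorem JointlyOrderReflecting.satisfies (hr : JointlyOrderReflecting h) {e : Inequation S}
    (he : ∀ i, (B i).Satisfies e) : A.Satisfies e := by
  refine Alg.satisfies_iff.2 fun f => ?_
  choose l hl r hr' hle using fun i => Alg.satisfies_iff.1 (he i) ((h i).toOrderHom.comp f)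
  obtain ⟨a, ha⟩ := hr.exists_mem_eval fun i => ⟨l i, hl i⟩
  obtain ⟨b, hb⟩ := hr.exists_mem_eval fun i => ⟨r i, hr' i⟩
  refine ⟨a, ha, b, hb, hr fun i => ?_⟩
  rw [Part.mem_unique ((h i).map_mem_eval ha) (hl i),
    Part.mem_unique ((h i).map_mem_eval hb) (hr' i)]
  exact hle i

theorem JointlyOrderReflecting.coherent (hr : JointlyOrderReflecting h)
    (hB : ∀ i, (B i).Coherent) : A.Coherent := fun σ f g hfg => hr fun i => by
  rw [(h i).map_op, (h i).map_op]
  exact hB i σ fun x => (h i).toOrderHom.monotone (hfg x)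

end JointlyOrderReflecting

section Split

variable {A B : Alg S}

/-- A monotone section `s` of a homomorphism; `s` need not commute with the operations. -/
def Alg.Hom.IsSection (h : Alg.Hom A B) (s : B.carrier →o A.carrier) : Prop :=
  h.toOrderHom.comp s = OrderHom.id

namespace Alg.Hom.IsSection

variable {h : Alg.Hom A B} {s : B.carrier →o A.carrier}

theorem comp_comp (hs : h.IsSection s) {Γ : PosF} (f : Γ.Elem →o B.carrier) :
    h.toOrderHom.comp (s.comp f) = f :=
  congrArg (fun k : B.carrier →o B.carrier => k.comp f) hs

theorem op_eq (hs : h.IsSection s) {Γ : PosF} (σ : S Γ) (f : Γ.Elem →o B.carrier) :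
    B.op σ f = h.toOrderHom (A.op σ (s.comp f)) := by
  rw [h.map_op, hs.comp_comp]

theorem map_op_of_comp (hs : h.IsSection s) {C : Alg S} {k : B.carrier →o C.carrier}
    {l : Alg.Hom A C} (hl : l.toOrderHom = k.comp h.toOrderHom) {Γ : PosF} (σ : S Γ)
    (f : Γ.Elem →o B.carrier) : k (B.op σ f) = C.op σ (k.comp f) :=
  calc k (B.op σ f) = k.comp h.toOrderHom (A.op σ (s.comp f)) := congrArg k (hs.op_eq σ f)
    _ = C.op σ (k.comp (h.toOrderHom.comp (s.comp f))) := by rw [← hl, l.map_op, hl]; rfl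
    _ = C.op σ (k.comp f) := by rw [hs.comp_comp]

theorem satisfies (hs : h.IsSection s) {e : Inequation S} (he : A.Satisfies e) :
    B.Satisfies e := by
  refine Alg.satisfies_iff.2 fun f => ?_
  obtain ⟨a, ha, b, hb, hab⟩ := Alg.satisfies_iff.1 he (s.comp f)
  rw [← hs.comp_comp f]
  exact ⟨_, h.map_mem_eval ha, _, h.map_mem_eval hb, h.toOrderHom.monotone hab⟩

theorem coherent (hs : h.IsSection s) (hA : A.Coherent) : B.Coherent := fun σ f g hfg => by
  rw [hs.op_eq, hs.op_eq]
  exact h.toOrderHom.monotone (hA σ fun x => s.monotone (hfg x))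

end Alg.Hom.IsSection

/-- The algebra structure on `Y` induced by a pair of monotone maps `q : A → Y` and `s : Y → A`. -/
noncomputable def Alg.induced (A : Alg S) {Y : PartOrd.{u}} (q : A.carrier →o Y)
    (s : Y →o A.carrier) : Alg S where
  carrier := Y
  op σ f := q (A.op σ (s.comp f))

/-- The map `q` as a homomorphism to the algebra it induces, provided that `q` cannot distinguish
the arguments `f` and `s ∘ q ∘ f` of an operation. -/
def Alg.toInduced (A : Alg S) {Y : PartOrd.{u}} (q : A.carrier →o Y)
    (s : Y →o A.carrier) (h : ∀ {Γ : PosF} (σ : S Γ) (f : Γ.Elem →o A.carrier),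
      q (A.op σ f) = q (A.op σ (s.comp (q.comp f)))) :
    Alg.Hom A (A.induced q s) where
  toOrderHom := q
  map_op σ f := h σ f

end Split

section Varietal

/-- The two closure properties of varieties that make them monadic: closure under subalgebras of
products and under homomorphic images along homomorphisms with a monotone section. -/
structure Varietal (P : Alg S → Prop) : Prop where
  of_jointlyOrderReflecting : ∀ {ι : Type (u + 1)} {A : Alg S} {B : ι → Alg S}
    {h : ∀ i, Alg.Hom A (B i)}, JointlyOrderReflecting h → (∀ i, P (B i)) → P A
  of_isSection : ∀ {A B : Alg S} {h : Alg.Hom A B} {s : B.carrier →o A.carrier},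
    h.IsSection s → P A → P B

theorem varietal_coherent : Varietal fun A : Alg S => A.Coherent where
  of_jointlyOrderReflecting hr := hr.coherent
  of_isSection hs := hs.coherent

theorem varietal_satisfies (E : Set (Inequation S)) :
    Varietal fun A : Alg S => ∀ e ∈ E, A.Satisfies e where
  of_jointlyOrderReflecting hr hB e he := hr.satisfies fun i => hB i e he
  of_isSection hs hA e he := hs.satisfies (hA e he)

theorem Varietal.and {P Q : Alg S → Prop} (hP : Varietal P) (hQ : Varietal Q) :
    Varietal fun A => P A ∧ Q A where
  of_jointlyOrderReflecting hr hB :=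
    ⟨hP.of_jointlyOrderReflecting hr fun i => (hB i).1,
      hQ.of_jointlyOrderReflecting hr fun i => (hB i).2⟩
  of_isSection hs hA := ⟨hP.of_isSection hs hA.1, hQ.of_isSection hs hA.2⟩

end Varietal

section GeneratedAlgebra

/-- Terms over an arbitrary, possibly infinite set `X` of generators. -/
inductive GenTerm (S : Signature.{u}) (X : Type u) : Type u
  | gen (x : X) : GenTerm S X
  | op {Γ : PosF} (σ : S Γ) (g : Γ.Elem → GenTerm S X) : GenTerm S X

variable {ι : Type*} (A : ι → Alg S) {X : Type u} [Preorder X] (f : ∀ i, X →o (A i).carrier)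

/-- `Denotes A f t a` says that `a` is the value of the term `t` in the product of the algebras
`A i`, where each generator `x` is interpreted by the tuple of the `f i x`. -/
inductive Denotes : GenTerm S X → (∀ i, (A i).carrier) → Prop
  | gen (x : X) : Denotes (.gen x) fun i => f i x
  | op {Γ : PosF} (σ : S Γ) (g : Γ.Elem → GenTerm S X) (v : Γ.Elem →o ∀ i, (A i).carrier)
      (hv : ∀ j, Denotes (g j) (v j)) :
      Denotes (.op σ g) fun i => (A i).op σ ((Pi.evalOrderHom i).comp v)

variable {A f} in
theorem Denotes.unique {t : GenTerm S X} {a b : ∀ i, (A i).carrier} (ha : Denotes A f t a)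
    (hb : Denotes A f t b) : a = b := by
  induction ha generalizing b with
  | gen x => cases hb; rfl
  | op σ g v _ ih =>
    cases hb with
    | op _ _ w hw =>
      obtain rfl : v = w := OrderHom.ext _ _ (funext fun j => ih j (hw j))
      rfl

/-- The underlying set of the subalgebra generated by `X` in the product of the algebras `A i`. -/
def generated : Set (∀ i, (A i).carrier) :=
  {a | ∃ t, Denotes A f t a}

instance small_generated : Small.{u} (generated A f) :=
  small_of_injective (β := GenTerm S X) (f := fun a => a.2.choose) fun a b hab =>
    Subtype.ext (a.2.choose_spec.unique (by
      rw [show a.2.choose = b.2.choose from hab]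
      exact b.2.choose_spec))

/-- The inclusion of the generated subalgebra into the product. The index type `ι` may be large, so
`Shrink` is needed to bring the carrier back to the universe of the generators. -/
noncomputable def generatedIncl : Shrink.{u} (generated A f) ↪o ∀ i, (A i).carrier :=
  (orderIsoShrink (generated A f)).symm.toOrderEmbedding.trans (OrderEmbedding.subtype _)

theorem denotes_generatedIncl (a : Shrink.{u} (generated A f)) :
    ∃ t, Denotes A f t (generatedIncl A f a) :=
  ((equivShrink (generated A f)).symm a).2

theorem generatedIncl_equivShrink (a : generated A f) :
    generatedIncl A f (equivShrink _ a) = a :=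
  congrArg Subtype.val ((equivShrink _).symm_apply_apply a)

/-- The subalgebra generated by `X` in the product of the algebras `A i`. -/
noncomputable def generatedAlg : Alg S where
  carrier := PartOrd.of (Shrink.{u} (generated A f))
  op σ g := equivShrink _ ⟨fun i => (A i).op σ
      ((Pi.evalOrderHom i).comp ((generatedIncl A f).toOrderHom.comp g)),
    _, .op σ _ _ fun j => (denotes_generatedIncl A f (g j)).choose_spec⟩

/-- The map of the generators into the subalgebra that they generate. -/
noncomputable def generatedUnit : X →o (generatedAlg A f).carrier where
  toFun x := equivShrink (generated A f) ⟨fun i => f i x, _, .gen x⟩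
  monotone' _ _ hxy := (orderIsoShrink (generated A f)).monotone fun i => (f i).monotone hxy

theorem generatedIncl_op {Γ : PosF} (σ : S Γ) (g : Γ.Elem →o (generatedAlg A f).carrier) :
    generatedIncl A f ((generatedAlg A f).op σ g) =
      fun i => (A i).op σ ((Pi.evalOrderHom i).comp ((generatedIncl A f).toOrderHom.comp g)) :=
  generatedIncl_equivShrink A f _

theorem generatedIncl_unit (x : X) :
    generatedIncl A f (generatedUnit A f x) = fun i => f i x :=
  generatedIncl_equivShrink A f _

/-- The projections of the subalgebra generated by `X` in the product of the algebras `A i`. -/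
noncomputable def generatedProj (i : ι) : Alg.Hom (generatedAlg A f) (A i) where
  toOrderHom := (Pi.evalOrderHom i).comp (generatedIncl A f).toOrderHom
  map_op σ g := congrFun (generatedIncl_op A f σ g) i

theorem generatedProj_comp_unit (i : ι) :
    (generatedProj A f i).toOrderHom.comp (generatedUnit A f) = f i :=
  OrderHom.ext _ _ (funext fun x => congrFun (generatedIncl_unit A f x) i)

theorem jointlyOrderReflecting_generatedProj : JointlyOrderReflecting (generatedProj A f) :=
  fun _ _ hab => (generatedIncl A f).le_iff_le.1 hab

variable {A f}

theorem generatedAlg_induction {p : (generatedAlg A f).carrier → Prop}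
    (unit : ∀ x, p (generatedUnit A f x))
    (op : ∀ {Γ : PosF} (σ : S Γ) (g : Γ.Elem →o (generatedAlg A f).carrier),
      (∀ j, p (g j)) → p ((generatedAlg A f).op σ g)) (a : (generatedAlg A f).carrier) : p a := by
  suffices ∀ t b, Denotes A f t b → ∀ a, generatedIncl A f a = b → p a by
    obtain ⟨t, ht⟩ := denotes_generatedIncl A f a
    exact this t _ ht a rfl
  intro t b hb
  induction hb with
  | gen x =>
    intro a ha
    obtain rfl : a = generatedUnit A f x :=
      (generatedIncl A f).injective (ha.trans (generatedIncl_unit A f x).symm)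
    exact unit x
  | @op Γ σ g v hv ih =>
    intro a ha
    let w : Γ.Elem →o (generatedAlg A f).carrier :=
      { toFun := fun j => equivShrink (generated A f) ⟨v j, g j, hv j⟩
        monotone' := fun _ _ hjk => (orderIsoShrink (generated A f)).monotone (v.monotone hjk) }
    have hw (j : Γ.Elem) : generatedIncl A f (w j) = v j := generatedIncl_equivShrink A f _
    have hvw : (generatedIncl A f).toOrderHom.comp w = v := OrderHom.ext _ _ (funext hw)
    obtain rfl : a = (generatedAlg A f).op σ w := (generatedIncl A f).injective <| by
      rw [ha, generatedIncl_op, hvw]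
    exact op σ w fun j => ih j _ (hw j)

theorem generatedAlg_hom_ext {B : Alg S} {h k : Alg.Hom (generatedAlg A f) B}
    (hk : h.toOrderHom.comp (generatedUnit A f) = k.toOrderHom.comp (generatedUnit A f)) :
    h = k := by
  refine Alg.Hom.ext (OrderHom.ext _ _ (funext fun a => ?_))
  induction a using generatedAlg_induction with
  | unit x => exact DFunLike.congr_fun hk x
  | op σ g ih =>
    rw [h.map_op, k.map_op]
    exact congrArg (B.op σ) (OrderHom.ext _ _ (funext ih))

theorem Varietal.exists_free {P : Alg S → Prop} (hP : Varietal P) (X : Type u) [PartialOrder X] :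
    ∃ (A : Alg S) (η : X →o A.carrier), P A ∧
      ∀ B, P B → ∀ f : X →o B.carrier, ∃! h : Alg.Hom A B, h.toOrderHom.comp η = f := by
  let B (i : Σ B : Subtype P, X →o B.1.carrier) : Alg S := i.1
  let f (i : Σ B : Subtype P, X →o B.1.carrier) : X →o (B i).carrier := i.2
  refine ⟨generatedAlg B f, generatedUnit B f,
    hP.of_jointlyOrderReflecting (jointlyOrderReflecting_generatedProj B f) fun i => i.1.2,
    fun C hC k => ?_⟩
  have hk := generatedProj_comp_unit B f ⟨⟨C, hC⟩, k⟩
  exact ⟨generatedProj B f ⟨⟨C, hC⟩, k⟩, hk, fun h hh => generatedAlg_hom_ext (hh.trans hk.symm)⟩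

end GeneratedAlgebra

section Monadicity

theorem amnestic_forget (S : Signature.{u}) : Amnestic (Alg.forget S) := by
  rintro ⟨X, o⟩ ⟨Y, o'⟩ e h he
  obtain rfl : X = Y := h
  have he' : e.hom.toOrderHom = OrderHom.id := congrArg PartOrd.Hom.hom he
  have ho : @o = @o' := by
    funext Γ σ f
    simpa [he'] using e.hom.map_op σ f
  rw [ho]

instance (S : Signature.{u}) : (Alg.forget S).Faithful :=
  ⟨fun h => Alg.Hom.ext (congrArg PartOrd.Hom.hom h)⟩

variable {P : Alg S → Prop} {V : Type*} [Category.{u} V] {I : V ⥤ Alg S}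

theorem Varietal.isRightAdjoint_forget [I.Full] [I.Faithful] (hP : Varietal P)
    (hI : ∀ A, P A ↔ ∃ v, I.obj v = A) : (I ⋙ Alg.forget S).IsRightAdjoint := by
  refine Functor.isRightAdjoint_of_leftAdjointObjIsDefined_eq_top (top_le_iff.1 fun X _ => ?_)
  obtain ⟨A, η, hA, free⟩ := hP.exists_free X
  obtain ⟨v, rfl⟩ := (hI A).1 hA
  have bij (w : V) : Function.Bijective fun k : v ⟶ w =>
      PartOrd.ofHom η ≫ (I ⋙ Alg.forget S).map k := by
    refine (Function.bijective_iff_existsUnique _).2 fun f => ?_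
    obtain ⟨h, hf, h_unique⟩ := free (I.obj w) ((hI _).2 ⟨w, rfl⟩) f.hom
    refine ⟨I.preimage h, PartOrd.hom_ext ?_, fun k hk => I.map_injective ?_⟩
    · rw [Functor.comp_map, I.map_preimage]
      exact hf
    · simpa using h_unique (I.map k) (congrArg PartOrd.Hom.hom hk)
  exact Functor.CorepresentableBy.isCorepresentable
    { homEquiv := Equiv.ofBijective _ (bij _)
      homEquiv_comp := fun g k => by
        rw [Equiv.ofBijective_apply, Functor.map_comp]
        rfl }

variable {F : PartOrd.{u} ⥤ V} (adj : F ⊣ I ⋙ Alg.forget S)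

/-- The unit of the adjunction as a monotone map into the carrier of the free algebra. -/
def unitMap (X : PartOrd.{u}) : X →o (I.obj (F.obj X)).carrier :=
  (adj.unit.app X).hom

/-- The counit of the adjunction as a homomorphism of `S`-algebras. -/
def counitHom (v : V) : I.obj (F.obj (I.obj v).carrier) ⟶ I.obj v :=
  I.map (adj.counit.app v)

theorem isSection_unitMap (v : V) :
    Alg.Hom.IsSection (counitHom adj v) (unitMap adj (I.obj v).carrier) :=
  congrArg PartOrd.Hom.hom (adj.right_triangle_components v)

theorem map_comp_unitMap {X Y : PartOrd.{u}} (k : X ⟶ Y) :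
    (I.map (F.map k)).toOrderHom.comp (unitMap adj X) = (unitMap adj Y).comp k.hom :=
  congrArg PartOrd.Hom.hom (adj.unit.naturality k).symm

theorem hom_ext_unitMap [I.Full] {X : PartOrd.{u}} {v : V} {h k : I.obj (F.obj X) ⟶ I.obj v}
    (hk : h.toOrderHom.comp (unitMap adj X) = k.toOrderHom.comp (unitMap adj X)) : h = k := by
  obtain ⟨h, rfl⟩ := I.map_surjective h
  obtain ⟨k, rfl⟩ := I.map_surjective k
  refine congrArg I.map ((adj.homEquiv X v).injective ?_)
  rw [adj.homEquiv_unit, adj.homEquiv_unit]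
  exact PartOrd.hom_ext hk

theorem comparison_full [I.Full] : (Monad.comparison adj).Full where
  map_surjective {v w} h := by
    let k : I.obj v ⟶ I.obj w :=
      ⟨h.f.hom, (isSection_unitMap adj v).map_op_of_comp (l := I.map (F.map h.f) ≫ counitHom adj w)
        (congrArg PartOrd.Hom.hom h.h)⟩
    exact ⟨I.preimage k, Monad.Algebra.Hom.ext (congrArg (Alg.forget S).map (I.map_preimage k))⟩

/-- The structure map of an Eilenberg-Moore algebra as a monotone map. -/
def structureMap (Y : adj.toMonad.Algebra) : (I.obj (F.obj Y.A)).carrier →o Y.A :=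
  Y.a.hom

theorem structureMap_comp_counitHom (Y : adj.toMonad.Algebra) :
    (structureMap adj Y).comp (counitHom adj (F.obj Y.A)).toOrderHom =
      (structureMap adj Y).comp (I.map (F.map Y.a)).toOrderHom :=
  congrArg PartOrd.Hom.hom Y.assoc

theorem structureMap_op (Y : adj.toMonad.Algebra) {Γ : PosF} (σ : S Γ)
    (f : Γ.Elem →o (I.obj (F.obj Y.A)).carrier) :
    structureMap adj Y ((I.obj (F.obj Y.A)).op σ f) =
      structureMap adj Y
        ((I.obj (F.obj Y.A)).op σ ((unitMap adj Y.A).comp ((structureMap adj Y).comp f))) := by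
  let A := I.obj (F.obj Y.A)
  let Ta := (I.map (F.map Y.a)).toOrderHom
  let σηf := (I.obj (F.obj A.carrier)).op σ ((unitMap adj A.carrier).comp f)
  calc structureMap adj Y (A.op σ f)
    _ = structureMap adj Y ((counitHom adj (F.obj Y.A)).toOrderHom σηf) :=
        congrArg (structureMap adj Y) ((isSection_unitMap adj (F.obj Y.A)).op_eq σ f)
    _ = structureMap adj Y (Ta σηf) := DFunLike.congr_fun (structureMap_comp_counitHom adj Y) _
    _ = structureMap adj Y (A.op σ ((Ta.comp (unitMap adj A.carrier)).comp f)) :=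
        congrArg (structureMap adj Y) ((I.map (F.map Y.a)).map_op σ _)
    _ = structureMap adj Y (A.op σ ((unitMap adj Y.A).comp ((structureMap adj Y).comp f))) :=
        congrArg (fun k : A.carrier →o A.carrier => structureMap adj Y (A.op σ (k.comp f)))
          (map_comp_unitMap adj Y.a)

/-- The `S`-algebra on the carrier of an Eilenberg-Moore algebra `(X, a)`, with
`σ(f) = a (σ (η ∘ f))`, where `η` is the unit of the adjunction. -/
noncomputable def emAlg (Y : adj.toMonad.Algebra) : Alg S :=
  (I.obj (F.obj Y.A)).induced (structureMap adj Y) (unitMap adj Y.A)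

/-- The structure map of an Eilenberg-Moore algebra as a homomorphism of `S`-algebras. -/
noncomputable def emHom (Y : adj.toMonad.Algebra) : I.obj (F.obj Y.A) ⟶ emAlg adj Y :=
  Alg.toInduced _ _ _ (structureMap_op adj Y)

theorem isSection_emHom (Y : adj.toMonad.Algebra) :
    Alg.Hom.IsSection (emHom adj Y) (unitMap adj Y.A) :=
  congrArg PartOrd.Hom.hom Y.unit

theorem map_comp_emHom [I.Full] (Y : adj.toMonad.Algebra) {v : V} (e : I.obj v ≅ emAlg adj Y) :
    I.map (F.map ((Alg.forget S).map e.hom)) ≫ emHom adj Y = counitHom adj v ≫ e.hom := by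
  have inv_emHom_map_unit (x : (I.obj v).carrier) :
      e.inv.toOrderHom ((emHom adj Y).toOrderHom
        ((I.map (F.map ((Alg.forget S).map e.hom))).toOrderHom (unitMap adj _ x))) = x :=
    calc
      _ = e.inv.toOrderHom ((emHom adj Y).toOrderHom (unitMap adj Y.A (e.hom.toOrderHom x))) :=
          congrArg (fun y => e.inv.toOrderHom ((emHom adj Y).toOrderHom y))
            (DFunLike.congr_fun (map_comp_unitMap adj ((Alg.forget S).map e.hom)) x)
      _ = e.inv.toOrderHom (e.hom.toOrderHom x) :=
          congrArg e.inv.toOrderHom (DFunLike.congr_fun (isSection_emHom adj Y) _)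
      _ = x := congrArg (fun k : I.obj v ⟶ I.obj v => k.toOrderHom x) e.hom_inv_id
  exact e.comp_inv_eq.1 (hom_ext_unitMap adj (OrderHom.ext _ _ (funext fun x =>
    (inv_emHom_map_unit x).trans (DFunLike.congr_fun (isSection_unitMap adj v) x).symm)))

/-- An isomorphism of `S`-algebras `I.obj v ≅ emAlg adj Y` is one of Eilenberg-Moore algebras. -/
noncomputable def comparisonIso [I.Full] {Y : adj.toMonad.Algebra} {v : V}
    (e : I.obj v ≅ emAlg adj Y) : (Monad.comparison adj).obj v ≅ Y :=
  Monad.Algebra.isoMk ((Alg.forget S).mapIso e)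
    (congrArg (Alg.forget S).map (map_comp_emHom adj Y e))

theorem Varietal.concretelyIsomorphic [I.Full] [I.Faithful] (hP : Varietal P)
    (hI : ∀ A, P A ↔ ∃ v, I.obj v = A) (hinj : Function.Injective I.obj) :
    ConcretelyIsomorphic (I ⋙ Alg.forget S) adj.toMonad.forget := by
  have := comparison_full adj
  refine .of_amnestic (Monad.comparison adj) rfl ((amnestic_forget S).comp_of_injective hinj)
    (amnestic_monad_forget _) fun Y => ?_
  obtain ⟨v, hv⟩ := (hI _).1 (hP.of_isSection (isSection_emHom adj Y) ((hI _).2 ⟨_, rfl⟩))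
  exact ⟨v, comparisonIso adj (eqToIso hv), congrArg Alg.carrier hv, eqToHom_map (Alg.forget S) hv⟩

end Monadicity

end OrdVar

/-- For every signature in context `S` and every set `E` of inequations in context, the forgetful
functor of the variety has a left adjoint, and for the monad of any such adjunction (the free-algebra
monad) the variety is isomorphic, as a concrete category over posets, to the Eilenberg-Moore category
of the monad. The same holds for the variety of coherent algebras. -/
theorem corollaryC (S : OrdVar.Signature.{u}) (E : Set (OrdVar.Inequation S)) :
    ((OrdVar.Variety.forget S E).IsRightAdjoint ∧
      ∀ (F : PartOrd.{u} ⥤ OrdVar.Variety S E) (adj : F ⊣ OrdVar.Variety.forget S E),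
        OrdVar.ConcretelyIsomorphic (OrdVar.Variety.forget S E) adj.toMonad.forget) ∧
    ((OrdVar.CohVariety.forget S E).IsRightAdjoint ∧
      ∀ (F : PartOrd.{u} ⥤ OrdVar.CohVariety S E) (adj : F ⊣ OrdVar.CohVariety.forget S E),
        OrdVar.ConcretelyIsomorphic (OrdVar.CohVariety.forget S E) adj.toMonad.forget) := by
  have hE := OrdVar.varietal_satisfies E
  have hC := OrdVar.varietal_coherent.and hE
  let I : OrdVar.CohVariety S E ⥤ OrdVar.Alg S := ObjectProperty.ι _ ⋙ ObjectProperty.ι _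
  have hIE (A : OrdVar.Alg S) : (∀ e ∈ E, A.Satisfies e) ↔ ∃ v : OrdVar.Variety S E, v.obj = A :=
    ⟨fun hA => ⟨⟨A, hA⟩, rfl⟩, by rintro ⟨v, rfl⟩; exact v.property⟩
  have hIC (A : OrdVar.Alg S) :
      (A.Coherent ∧ ∀ e ∈ E, A.Satisfies e) ↔ ∃ v : OrdVar.CohVariety S E, I.obj v = A :=
    ⟨fun hA => ⟨⟨⟨A, hA.1⟩, hA.2⟩, rfl⟩, by rintro ⟨v, rfl⟩; exact ⟨v.obj.property, v.property⟩⟩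
  refine ⟨⟨hE.isRightAdjoint_forget (I := ObjectProperty.ι _) hIE, fun F adj => ?_⟩,
    ⟨hC.isRightAdjoint_forget (I := I) hIC, fun F adj => ?_⟩⟩
  · exact hE.concretelyIsomorphic (I := ObjectProperty.ι _) adj hIE
      fun _ _ => ObjectProperty.FullSubcategory.ext
  · exact hC.concretelyIsomorphic (I := I) adj hIC
      fun _ _ h => ObjectProperty.FullSubcategory.ext (ObjectProperty.FullSubcategory.ext h)
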